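/- Write $B_1(x)$ for the open Euclidean ball of radius $1$ centred at $x\in\mathbb{R}^d$. For $\Lambda\subseteq\mathbb{R}^d$ let $\operatorname{rel}(\Lambda)=\sup_{x\in\mathbb{R}^d}\#(\Lambda\cap B_1(x))$, and call $\Lambda$ relatively separated if $\operatorname{rel}(\Lambda)<\infty$. Let $W(C_0,L^1)(\mathbb{R}^d)$ be the space of continuous bounded functions $f$ on $\mathbb{R}^d$ with $\int_{\mathbb{R}^d}\|f\|_{L^\infty(B_1(x))}\,dx<\infty$. Theorem. Let $\Lambda,\Gamma\subseteq\mathbb{R}^d$ be relatively separated, and let $P:\ell^2(\Gamma)\to\ell^2(\Gamma)$ and $A:\ell^2(\Gamma)\to\ell^2(\Lambda)$ be bounded operators, represented by matrices $P=(P_{\gamma,\gamma'})_{\gamma,\gamma'\in\Gamma}$ and $A=(A_{\lambda,\gamma})_{\lambda\in\Lambda,\gamma\in\Gamma}$. Assume that $P^2=P$ and that, for some real-valued $\Theta\in W(C_0,L^1)(\mathbb{R}^d)$, $$|A_{\lambda,\gamma}|\le\Theta(\lambda-\gamma)\quad(\lambda\in\Lambda,\ \gamma\in\Gamma),\qquad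 |P_{\gamma,\gamma'}|\le\Theta(\gamma-\gamma')\quad(\gamma,\gamma'\in\Gamma).$$ Then for every $q\in[1,\infty]$ the matrices act on $\ell^q$: the series defining $Pc$ and $Ac$ converge for all $c\in\ell^q(\Gamma)$, with $Pc\in\ell^q(\Gamma)$ and $Ac\in\ell^q(\Lambda)$. Let moreover $p\in[1,\infty]$ and assume that there is $C_p>0$ such that $$\|APc\|_p\ge C_p\|Pc\|_p,\qquad c\in\ell^p(\Gamma).$$ Then there exists $C'>0$ such that for all $q\in[1,\infty]$ $$\|APc\|_q\ge C'\|Pc\|_q,\qquad c\in\ell^q(\Gamma).$$ Moreover, $C'$ is independent of $q$ and depends only on $\Theta$ (and the dimension $d$), $C_p$, and upper bounds for $\operatorname{rel}(\Lambda)$ and $\operatorname{rel}(\Gamma)$. -/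

import Mathlib

open MeasureTheory
open scoped ENNReal

/-- The relative separation `rel(Λ) = sup_x #(Λ ∩ B₁(x))` of a set `Λ ⊆ ℝ^d`, with values in
`ℕ ∪ {∞}`. The set `Λ` is relatively separated if and only if `rel(Λ) < ∞`, that is, if and only
if `rel(Λ) ≤ R` for some natural number `R`. -/
noncomputable def relSep {d : ℕ} (L : Set (EuclideanSpace ℝ (Fin d))) : ℕ∞ :=
  ⨆ x : EuclideanSpace ℝ (Fin d), (L ∩ Metric.ball x 1).encard

/-- The amalgam norm `∫ ‖f‖_{L^∞(B₁(x))} dx`, with values in `[0, ∞]`. -/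
noncomputable def amalgamNorm {d : ℕ} (f : EuclideanSpace ℝ (Fin d) → ℝ) : ℝ≥0∞ :=
  ∫⁻ x, eLpNorm f ∞ (volume.restrict (Metric.ball x 1))

/-- Membership in the amalgam space `W(L^∞, L^1)(ℝ^d)` (real-valued functions). -/
def MemAmalgamLinfL1 {d : ℕ} (f : EuclideanSpace ℝ (Fin d) → ℝ) : Prop :=
  MemLp f ∞ volume ∧ amalgamNorm f < ∞

/-- Membership in the amalgam space `W(C₀, L^1)(ℝ^d)`: the continuous functions in
`W(L^∞, L^1)(ℝ^d)`. -/
def MemAmalgamC0L1 {d : ℕ} (f : EuclideanSpace ℝ (Fin d) → ℝ) : Prop :=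
  Continuous f ∧ MemAmalgamLinfL1 f

/-- The space `ℓ^p(S)` of complex-valued sequences indexed by `S`. -/
noncomputable abbrev Ell (p : ℝ≥0∞) (S : Type*) := lp (fun _ : S => ℂ) p

open Classical in
/-- The matrix representing a bounded operator `T : ℓ²(S) → ℓ²(S')` in the standard bases:
`T_{i,j} = (T e_j)_i`. -/
noncomputable def opMatrix {S S' : Type*} (T : Ell 2 S →L[ℂ] Ell 2 S') : Matrix S' S ℂ :=
  fun i j => T (lp.single 2 j (1 : ℂ)) i

/-- `IsMatrixImage M c u` says that `u = M c`, the matrix acting on sequences: for every row `i`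
the series `∑_j M_{i,j} c_j` converges unconditionally, with sum `u_i`. -/
def IsMatrixImage {S S' : Type*} (M : Matrix S' S ℂ) (c : S → ℂ) (u : S' → ℂ) : Prop :=
  ∀ i, HasSum (fun j => M i j * c j) (u i)

/-- `BoundedBelowOnRange A P p C` says that `‖A P c‖_p ≥ C ‖P c‖_p` for all `c ∈ ℓ^p(S)`, where
the matrices act on `ℓ^p`; here `u = P c` and `v = A u = A P c`. -/
def BoundedBelowOnRange {S S' : Type*} (A : Matrix S' S ℂ) (P : Matrix S S ℂ) (p : ℝ≥0∞)
    (C : ℝ) : Prop :=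
  ∀ (c u : Ell p S) (v : Ell p S'), IsMatrixImage P c u → IsMatrixImage A u v → C * ‖u‖ ≤ ‖v‖

/-- The matrix `M` maps `ℓ^q(S)` into `ℓ^q(S')`: the series defining `M c` converge for every
`c ∈ ℓ^q(S)`, and `M c ∈ ℓ^q(S')`. -/
def ActsOnEll {S S' : Type*} (M : Matrix S' S ℂ) (q : ℝ≥0∞) : Prop :=
  ∀ c : Ell q S, ∃ u : Ell q S', IsMatrixImage M c u

/-! The proof localizes and absorbs commutators. Let `φ_k` (`bump s k`) be Lipschitz bumps at a
large scale `s`, each at least `1` on its cube and with bounded overlap. Put `u = Pc`, so `Pu = u`,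
and `v = Au`. Applying the `ℓ^p` lower bound to `φ_k u` gives `‖AP(φ_k u)‖_p ≥ C_p ‖P(φ_k u)‖_p`.
Moving `φ_k` past `P` and `A` costs commutators with entries at most `|Θ(x - y)| |φ_k(x) - φ_k(y)|`.
From cube `j` such a commutator has Schur bound `β(k - j)`, and `∑ β` tends to `0` as `s → ∞`
(`exists_scale_tsum_commBound_le`): the Lipschitz bound contributes `min (d + 1) (|z| / s)`, and
dominated convergence applies since `Θ` lies in the amalgam space. Hence the local norms `a_k = ‖u
1_{Q_k}‖_p` satisfy `C_p a_k ≤ ∑ |φ_k v| + K (β * a)_k` (`lpn_cubePart_le`). Taking `ℓ^q` norms in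
`k`, Young's inequality bounds the last term by `(C_p / 2) ‖a‖_q`, which is absorbed. Finally
`‖a‖_q` is comparable to `‖u‖_q` with constants independent of `p` and `q`, because a cube contains
boundedly many points of `Γ`. -/

/-- The `ℓ^p` norm, with values in `[0, ∞]`, of a family of extended nonnegative reals. -/
noncomputable def lpn {X : Type*} (p : ℝ≥0∞) (f : X → ℝ≥0∞) : ℝ≥0∞ :=
  if p = ∞ then ⨆ x, f x else (∑' x, f x ^ p.toReal) ^ (1 / p.toReal)

/-! ### Extended-valued `ℓ^p` norms and Schur's test -/

section lpn
variable {X Y J : Type*} {p : ℝ≥0∞}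

theorem one_le_toReal_of_ne_top (hp : 1 ≤ p) (h : p ≠ ∞) : 1 ≤ p.toReal := by
  simpa using ENNReal.toReal_mono h hp

theorem lpn_top (f : X → ℝ≥0∞) : lpn ∞ f = ⨆ x, f x := by simp [lpn]

theorem lpn_of_ne_top (h : p ≠ ∞) (f : X → ℝ≥0∞) :
    lpn p f = (∑' x, f x ^ p.toReal) ^ (1 / p.toReal) := by simp [lpn, h]

theorem lpn_le_iff_of_ne_top (hp : 1 ≤ p) (h : p ≠ ∞) {f : X → ℝ≥0∞} {C : ℝ≥0∞} :
    lpn p f ≤ C ↔ ∑' x, f x ^ p.toReal ≤ C ^ p.toReal := by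
  rw [lpn_of_ne_top h, one_div,
    ENNReal.rpow_inv_le_iff (zero_lt_one.trans_le (one_le_toReal_of_ne_top hp h))]

theorem lpn_rpow_of_ne_top (hp : 1 ≤ p) (h : p ≠ ∞) (f : X → ℝ≥0∞) :
    lpn p f ^ p.toReal = ∑' x, f x ^ p.toReal := by
  have := one_le_toReal_of_ne_top hp h
  rw [lpn_of_ne_top h, ← ENNReal.rpow_mul, one_div, inv_mul_cancel₀ (by linarith),
    ENNReal.rpow_one]

theorem le_lpn (hp : 1 ≤ p) (f : X → ℝ≥0∞) (x : X) : f x ≤ lpn p f := by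
  by_cases h : p = ∞
  · subst h; rw [lpn_top]; exact le_iSup f x
  · have h1 := one_le_toReal_of_ne_top hp h
    rw [← ENNReal.rpow_le_rpow_iff (zero_lt_one.trans_le h1), lpn_rpow_of_ne_top hp h]
    exact ENNReal.le_tsum x

theorem lpn_mono (hp : 1 ≤ p) {f g : X → ℝ≥0∞} (hfg : ∀ x, f x ≤ g x) : lpn p f ≤ lpn p g := by
  by_cases h : p = ∞
  · subst h; rw [lpn_top, lpn_top]; exact iSup_mono hfg
  · rw [lpn_le_iff_of_ne_top hp h, lpn_rpow_of_ne_top hp h]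
    exact ENNReal.tsum_le_tsum fun x => ENNReal.rpow_le_rpow (hfg x) (by positivity)

theorem lpn_le_tsum (hp : 1 ≤ p) (f : X → ℝ≥0∞) : lpn p f ≤ ∑' x, f x := by
  by_cases h : p = ∞
  · subst h; rw [lpn_top]; exact iSup_le fun x => ENNReal.le_tsum x
  · have h1 := one_le_toReal_of_ne_top hp h
    -- Writing `a ^ r = a * a ^ (r - 1)` allows the second factor of each term to be bounded by the
    -- full sum.
    have split (a : ℝ≥0∞) : a ^ p.toReal = a * a ^ (p.toReal - 1) := by
      conv_rhs => rw [← ENNReal.rpow_one a, ← ENNReal.rpow_mul, one_mul,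
        ← ENNReal.rpow_add_of_nonneg _ _ zero_le_one (by linarith)]
      congr 1; ring
    rw [lpn_le_iff_of_ne_top hp h, split (∑' x, f x), ← ENNReal.tsum_mul_right]
    refine ENNReal.tsum_le_tsum fun x => ?_
    rw [split]
    gcongr
    exact ENNReal.le_tsum x

theorem lpn_const_mul (hp : 1 ≤ p) (a : ℝ≥0∞) (f : X → ℝ≥0∞) :
    lpn p (fun x => a * f x) = a * lpn p f := by
  by_cases h : p = ∞
  · subst h; rw [lpn_top, lpn_top, ENNReal.mul_iSup]
  · have h1 := one_le_toReal_of_ne_top hp h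
    rw [lpn_of_ne_top h, lpn_of_ne_top h]
    simp_rw [ENNReal.mul_rpow_of_nonneg _ _ (by positivity : 0 ≤ p.toReal)]
    rw [ENNReal.tsum_mul_left, ENNReal.mul_rpow_of_nonneg _ _ (by positivity),
      ← ENNReal.rpow_mul, mul_one_div, div_self (by linarith), ENNReal.rpow_one]

theorem lpn_zero (hp : 1 ≤ p) : lpn p (fun _ : X => 0) = 0 :=
  le_antisymm ((lpn_le_tsum hp _).trans (by simp)) zero_le

theorem lpn_add_le (hp : 1 ≤ p) (f g : X → ℝ≥0∞) :
    lpn p (fun x => f x + g x) ≤ lpn p f + lpn p g := by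
  by_cases h : p = ∞
  · subst h; rw [lpn_top, lpn_top, lpn_top]
    exact iSup_le fun x => add_le_add (le_iSup f x) (le_iSup g x)
  · have h1 := one_le_toReal_of_ne_top hp h
    have h0 := zero_lt_one.trans_le h1
    rw [lpn_le_iff_of_ne_top hp h, ENNReal.tsum_eq_iSup_sum]
    refine iSup_le fun s => ?_
    rw [← ENNReal.rpow_inv_le_iff h0, ← one_div]
    refine (ENNReal.Lp_add_le s f g h1).trans ?_
    rw [lpn_of_ne_top h, lpn_of_ne_top h]
    gcongr <;> exact ENNReal.sum_le_tsum s

theorem lpn_finset_sum_le (hp : 1 ≤ p) (s : Finset J) (f : J → X → ℝ≥0∞) :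
    lpn p (fun x => ∑ j ∈ s, f j x) ≤ ∑ j ∈ s, lpn p (f j) := by
  classical
  induction s using Finset.induction_on with
  | empty => simp [lpn_zero hp]
  | insert j s hj ih =>
    simp_rw [Finset.sum_insert hj]
    exact (lpn_add_le hp _ _).trans (by gcongr)

theorem lpn_tsum_le (hp : 1 ≤ p) (f : J → X → ℝ≥0∞) :
    lpn p (fun x => ∑' j, f j x) ≤ ∑' j, lpn p (f j) := by
  have key (s : Finset J) : lpn p (fun x => ∑ j ∈ s, f j x) ≤ ∑' j, lpn p (f j) :=
    (lpn_finset_sum_le hp s f).trans (ENNReal.sum_le_tsum s)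
  by_cases h : p = ∞
  · subst h; rw [lpn_top]
    refine iSup_le fun x => ?_
    rw [ENNReal.tsum_eq_iSup_sum]
    exact iSup_le fun s => (le_lpn hp (fun x => ∑ j ∈ s, f j x) x).trans (key s)
  · rw [lpn_le_iff_of_ne_top hp h, ENNReal.tsum_eq_iSup_sum]
    refine iSup_le fun t => ?_
    refine le_of_tendsto' (tendsto_finsetSum t fun x _ =>
      (ENNReal.continuous_rpow_const.tendsto _).comp
        (ENNReal.summable (f := fun j => f j x)).hasSum) fun s => ?_
    exact (ENNReal.sum_le_tsum t).trans ((lpn_le_iff_of_ne_top hp h).1 (key s))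

/-- **Schur's test** for nonnegative kernels. -/
theorem lpn_kernel_le (hp : 1 ≤ p) {K : X → Y → ℝ≥0∞} {S : ℝ≥0∞} (hrow : ∀ x, ∑' y, K x y ≤ S)
    (hcol : ∀ y, ∑' x, K x y ≤ S) (f : Y → ℝ≥0∞) :
    lpn p (fun x => ∑' y, K x y * f y) ≤ S * lpn p f := by
  by_cases h : p = ∞
  · subst h; rw [lpn_top, lpn_top]
    refine iSup_le fun x => ?_
    calc ∑' y, K x y * f y ≤ ∑' y, K x y * ⨆ y, f y := by gcongr; exact le_iSup f _
      _ = (∑' y, K x y) * ⨆ y, f y := ENNReal.tsum_mul_right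
      _ ≤ S * ⨆ y, f y := by gcongr; exact hrow x
  · have h1 := one_le_toReal_of_ne_top hp h
    have h0 := zero_lt_one.trans_le h1
    set r := p.toReal
    have hinv : 0 ≤ 1 - r⁻¹ := by
      rw [sub_nonneg]; exact inv_le_one_of_one_le₀ h1
    have row (x : X) : (∑' y, K x y * f y) ^ r ≤ S ^ (r - 1) * ∑' y, K x y * f y ^ r := by
      have : ∑' y, K x y * f y ≤ S ^ (1 - r⁻¹) * (∑' y, K x y * f y ^ r) ^ r⁻¹ := by
        rw [ENNReal.tsum_eq_iSup_sum]
        refine iSup_le fun s => ?_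
        -- Hölder's inequality with respect to the weights `K x ·`, whose total mass is at most `S`.
        refine (ENNReal.inner_le_weight_mul_Lp_of_nonneg s h1 (K x) f).trans ?_
        gcongr
        · exact (ENNReal.sum_le_tsum s).trans (hrow x)
        · exact ENNReal.sum_le_tsum s
      calc (∑' y, K x y * f y) ^ r ≤ (S ^ (1 - r⁻¹) * (∑' y, K x y * f y ^ r) ^ r⁻¹) ^ r := by
            gcongr
        _ = _ := by
            rw [ENNReal.mul_rpow_of_nonneg _ _ h0.le, ← ENNReal.rpow_mul, ← ENNReal.rpow_mul,
              inv_mul_cancel₀ h0.ne', ENNReal.rpow_one, sub_mul, inv_mul_cancel₀ h0.ne', one_mul]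
    rw [lpn_le_iff_of_ne_top hp h, ENNReal.mul_rpow_of_nonneg _ _ h0.le, lpn_rpow_of_ne_top hp h]
    calc ∑' x, (∑' y, K x y * f y) ^ r ≤ ∑' x, S ^ (r - 1) * ∑' y, K x y * f y ^ r :=
          ENNReal.tsum_le_tsum row
      _ = S ^ (r - 1) * ∑' y, (∑' x, K x y) * f y ^ r := by
          rw [ENNReal.tsum_mul_left, ENNReal.tsum_comm]
          simp_rw [ENNReal.tsum_mul_right]
      _ ≤ S ^ (r - 1) * ∑' y, S * f y ^ r := by gcongr with y; exact hcol y
      _ = S ^ r * ∑' y, f y ^ r := by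
          rw [ENNReal.tsum_mul_left, ← mul_assoc]
          congr 1
          conv_lhs => rw [← ENNReal.rpow_one S, ← ENNReal.rpow_mul, one_mul,
            ← ENNReal.rpow_add_of_nonneg _ _ (by linarith) zero_le_one]
          congr 1; ring

theorem ofReal_norm_eq_lpn (hp : 1 ≤ p) (u : Ell p X) :
    ENNReal.ofReal ‖u‖ = lpn p (fun x => ‖u x‖ₑ) := by
  by_cases h : p = ∞
  · subst h
    rw [lpn_top]
    apply le_antisymm
    · by_cases hC : (⨆ x, ‖u x‖ₑ) = ∞
      · simp [hC]
      · refine ENNReal.ofReal_le_of_le_toReal (lp.norm_le_of_forall_le (by positivity) fun x => ?_)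
        rw [← toReal_enorm]
        exact ENNReal.toReal_mono hC (le_iSup (fun x => ‖u x‖ₑ) x)
    · refine iSup_le fun x => ?_
      rw [← ofReal_norm]
      exact ENNReal.ofReal_le_ofReal (lp.norm_apply_le_norm (by simp) u x)
  · have h1 := one_le_toReal_of_ne_top hp h
    have h0 := zero_lt_one.trans_le h1
    rw [lpn_of_ne_top h, lp.norm_eq_tsum_rpow h0,
      ← ENNReal.ofReal_rpow_of_nonneg (tsum_nonneg fun _ => by positivity) (by positivity),
      ENNReal.ofReal_tsum_of_nonneg (fun _ => by positivity) ((lp.memℓp u).summable h0)]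
    congr 1
    refine tsum_congr fun x => ?_
    rw [← ENNReal.ofReal_rpow_of_nonneg (norm_nonneg _) h0.le, ofReal_norm]

theorem memℓp_of_lpn_lt_top (hp : 1 ≤ p) {u : X → ℂ} (hu : lpn p (fun x => ‖u x‖ₑ) < ∞) :
    Memℓp u p := by
  by_cases h : p = ∞
  · subst h
    refine memℓp_infty ⟨(lpn ∞ (fun x => ‖u x‖ₑ)).toReal, ?_⟩
    rintro _ ⟨x, rfl⟩
    simp only
    rw [← toReal_enorm]
    exact ENNReal.toReal_mono hu.ne (le_lpn hp (fun x => ‖u x‖ₑ) x)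
  · have h1 := one_le_toReal_of_ne_top hp h
    have h0 := zero_lt_one.trans_le h1
    apply memℓp_gen
    have := lpn_rpow_of_ne_top hp h (fun x => ‖u x‖ₑ)
    have hfin : ∑' x, ‖u x‖ₑ ^ p.toReal ≠ ∞ := by
      rw [← this]; exact ENNReal.rpow_ne_top_of_nonneg h0.le hu.ne
    refine (ENNReal.summable_toReal hfin).congr fun x => ?_
    rw [← ENNReal.toReal_rpow, toReal_enorm]

end lpn

/-! ### Local suprema and sums over relatively separated sets -/

section geometry
variable {d : ℕ}

local notation "𝔼" => EuclideanSpace ℝ (Fin d)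

/-- The local supremum `sup_{z ∈ B₁(w)} |f(z)|`. -/
noncomputable def localSup (f : EuclideanSpace ℝ (Fin d) → ℝ) (w : EuclideanSpace ℝ (Fin d)) :
    ℝ≥0∞ :=
  ⨆ z ∈ Metric.ball w 1, ‖f z‖ₑ

theorem enorm_le_localSup (f : 𝔼 → ℝ) {z w : 𝔼} (h : dist z w < 1) : ‖f z‖ₑ ≤ localSup f w :=
  le_iSup₂ (f := fun z (_ : z ∈ Metric.ball w 1) => ‖f z‖ₑ) z h

theorem measurable_localSup (f : 𝔼 → ℝ) : Measurable (localSup f) := by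
  refine LowerSemicontinuous.measurable fun w a ha => ?_
  obtain ⟨z, hz⟩ := lt_iSup_iff.1 ha
  obtain ⟨hzw, hz⟩ := lt_iSup_iff.1 hz
  filter_upwards [Metric.isOpen_ball.mem_nhds (Metric.mem_ball_comm.1 hzw)] with w' hw'
  exact hz.trans_le (enorm_le_localSup f (Metric.mem_ball_comm.1 hw'))

/-- By continuity, exceeding the essential supremum at one point means exceeding it on a nonempty
open set, which has positive measure. True suprema are needed because `Θ` is sampled at individual
points. -/
theorem localSup_le_eLpNorm {f : 𝔼 → ℝ} (hf : Continuous f) (w : 𝔼) :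
    localSup f w ≤ eLpNorm f ∞ (volume.restrict (Metric.ball w 1)) := by
  refine iSup₂_le fun z hz => ?_
  by_contra! hlt
  rw [eLpNorm_exponent_top] at hlt
  have hae := ae_le_eLpNormEssSup (f := f) (μ := volume.restrict (Metric.ball w 1))
  rw [ae_restrict_iff' Metric.isOpen_ball.measurableSet] at hae
  have hopen : IsOpen (Metric.ball w 1 ∩
      {y | eLpNormEssSup f (volume.restrict (Metric.ball w 1)) < ‖f y‖ₑ}) :=
    Metric.isOpen_ball.inter (isOpen_lt continuous_const hf.enorm)
  refine (hopen.measure_pos volume ⟨z, hz, hlt⟩).ne' (measure_mono_null ?_ (ae_iff.1 hae))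
  rintro y ⟨hy, hlt'⟩ h
  exact (h hy).not_gt hlt'

theorem lintegral_localSup_lt_top {f : 𝔼 → ℝ} (hf : MemAmalgamC0L1 f) :
    ∫⁻ w, localSup f w < ∞ :=
  (lintegral_mono fun w => localSup_le_eLpNorm hf.1 w).trans_lt hf.2.2

/-- Each `H (e x)` is at most the average of `G` over the unit ball at `e x`, and at most `R` of
these balls cover any given point. The isometry `e` treats `t - x` and `x - t`, hence row and column
sums, at once. -/
theorem tsum_le_lintegral_of_relSep_le {L : Set 𝔼} {R : ℕ} (hL : relSep L ≤ R)
    {H G : 𝔼 → ℝ≥0∞} (hHG : ∀ z w, dist z w < 1 → H z ≤ G w) (e : 𝔼 ≃ᵢ 𝔼) :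
    ∑' x : L, H (e x) ≤ R / volume (Metric.ball (0 : 𝔼) 1) * ∫⁻ w, G w := by
  classical
  have hv0 : volume (Metric.ball (0 : 𝔼) 1) ≠ 0 :=
    (Metric.measure_ball_pos _ _ one_pos).ne'
  have hvt : volume (Metric.ball (0 : 𝔼) 1) ≠ ∞ := measure_ball_lt_top.ne
  rw [ENNReal.mul_comm_div, ← mul_div_assoc, ENNReal.le_div_iff_mul_le (.inl hv0) (.inl hvt),
    ENNReal.tsum_eq_iSup_sum, ENNReal.iSup_mul]
  refine iSup_le fun s => ?_
  have hcount (w : 𝔼) :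
      ∑ x ∈ s, (Metric.ball (e x) 1).indicator (1 : 𝔼 → ℝ≥0∞) w ≤ R := by
    have h1 : ((s.filter fun x : L => w ∈ Metric.ball (e x) 1).card : ℕ∞) ≤ R := by
      -- The centres `e x` within distance `1` of `w` correspond to points of `L` in the unit ball
      -- at `e.symm w`.
      refine le_trans ?_ ((le_iSup (fun y => (L ∩ Metric.ball y 1).encard) (e.symm w)).trans hL)
      rw [← Finset.card_map (Function.Embedding.subtype (· ∈ L)), ← Set.encard_coe_eq_coe_finsetCard]
      refine Set.encard_le_encard fun y hy => ?_
      simp only [Finset.coe_map, Finset.coe_filter, Set.mem_image, Set.mem_ofPred_eq] at hy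
      obtain ⟨x, ⟨-, hx⟩, rfl⟩ := hy
      refine ⟨x.2, ?_⟩
      rw [Metric.mem_ball, ← e.dist_eq, e.apply_symm_apply, dist_comm]
      exact hx
    simp only [Set.indicator_apply, Pi.one_apply, Finset.sum_boole]
    exact_mod_cast h1
  calc (∑ x ∈ s, H (e x)) * volume (Metric.ball (0 : 𝔼) 1)
      = ∑ x ∈ s, ∫⁻ w, H (e x) * (Metric.ball (e x) 1).indicator 1 w := by
        rw [Finset.sum_mul]
        refine Finset.sum_congr rfl fun x _ => ?_
        rw [lintegral_const_mul _ (measurable_one.indicator measurableSet_ball),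
          lintegral_indicator_one measurableSet_ball, ← Measure.addHaar_ball_center volume (e x) 1]
    _ = ∫⁻ w, ∑ x ∈ s, H (e x) * (Metric.ball (e x) 1).indicator 1 w :=
        (lintegral_finsetSum _ fun x _ =>
          (measurable_one.indicator measurableSet_ball).const_mul _).symm
    _ ≤ ∫⁻ w, R * G w := by
        refine lintegral_mono fun w => ?_
        calc ∑ x ∈ s, H (e x) * (Metric.ball (e x) 1).indicator 1 w
            ≤ ∑ x ∈ s, (Metric.ball (e x) 1).indicator 1 w * G w := by
              refine Finset.sum_le_sum fun x _ => ?_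
              by_cases hw : w ∈ Metric.ball (e x) 1
              · simpa [hw] using hHG _ _ (Metric.mem_ball'.1 hw)
              · simp [hw]
          _ ≤ R * G w := by rw [← Finset.sum_mul]; gcongr; exact hcount w
    _ = R * ∫⁻ w, G w := lintegral_const_mul' _ _ (by simp)

theorem tsum_sub_left_le {L : Set 𝔼} {R : ℕ} (hL : relSep L ≤ R)
    {H G : 𝔼 → ℝ≥0∞} (hHG : ∀ z w, dist z w < 1 → H z ≤ G w) (t : 𝔼) :
    ∑' x : L, H (t - x) ≤ R / volume (Metric.ball (0 : 𝔼) 1) * ∫⁻ w, G w :=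
  tsum_le_lintegral_of_relSep_le hL hHG (IsometryEquiv.subLeft t)

theorem tsum_sub_right_le {L : Set 𝔼} {R : ℕ} (hL : relSep L ≤ R)
    {H G : 𝔼 → ℝ≥0∞} (hHG : ∀ z w, dist z w < 1 → H z ≤ G w) (t : 𝔼) :
    ∑' x : L, H (x - t) ≤ R / volume (Metric.ball (0 : 𝔼) 1) * ∫⁻ w, G w :=
  tsum_le_lintegral_of_relSep_le hL hHG (IsometryEquiv.subRight t)

/-! ### Cubes and Lipschitz bumps at scale `s` -/

/-- The lattice point of `ℤ^d ⊆ ℝ^d` with the given coordinates. -/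
noncomputable def latticePt (k : Fin d → ℤ) : EuclideanSpace ℝ (Fin d) :=
  WithLp.toLp 2 fun i => (k i : ℝ)

/-- The index of the half-open cube of side `s` that contains `x`. -/
noncomputable def cubeIndex (s : ℝ) (x : EuclideanSpace ℝ (Fin d)) : Fin d → ℤ :=
  fun i => ⌊s⁻¹ * x i⌋

/-- A Lipschitz bump at scale `s`, at least `1` on the cube with index `k`. -/
noncomputable def bump (s : ℝ) (k : Fin d → ℤ) (x : EuclideanSpace ℝ (Fin d)) : ℝ :=
  max 0 (d + 1 - ‖s⁻¹ • x - latticePt k‖)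

theorem latticePt_sub (j k : Fin d → ℤ) :
    (latticePt (j - k) : 𝔼) = latticePt j - latticePt k := by
  ext i; simp [latticePt]

theorem norm_sub_latticePt_cubeIndex_le (s : ℝ) (x : 𝔼) :
    ‖s⁻¹ • x - latticePt (cubeIndex s x)‖ ≤ d := by
  have h (i : Fin d) : ‖(s⁻¹ • x - latticePt (cubeIndex s x) : 𝔼) i‖ ≤ 1 := by
    simp only [PiLp.sub_apply, PiLp.smul_apply, smul_eq_mul, latticePt, cubeIndex, Real.norm_eq_abs]
    rw [abs_of_nonneg (sub_nonneg.2 (Int.floor_le _))]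
    linarith [Int.lt_floor_add_one (s⁻¹ * x i)]
  rw [EuclideanSpace.norm_eq]
  refine Real.sqrt_le_iff.2 ⟨by positivity, ?_⟩
  calc ∑ i, ‖(s⁻¹ • x - latticePt (cubeIndex s x) : 𝔼) i‖ ^ 2 ≤ ∑ i : Fin d, (1 : ℝ) :=
        Finset.sum_le_sum fun i _ => pow_le_one₀ (norm_nonneg _) (h i)
    _ = d := by simp
    -- The crude bound `d` in place of `√d` keeps all radii integral.
    _ ≤ (d : ℝ) ^ 2 := by exact_mod_cast Nat.le_self_pow two_ne_zero d

theorem bump_nonneg (s : ℝ) (k : Fin d → ℤ) (x : 𝔼) : 0 ≤ bump s k x := le_max_left _ _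

theorem bump_le (s : ℝ) (k : Fin d → ℤ) (x : 𝔼) : bump s k x ≤ d + 1 :=
  max_le (by positivity) (by linarith [norm_nonneg (s⁻¹ • x - latticePt k)])

theorem one_le_bump (s : ℝ) (x : 𝔼) : 1 ≤ bump s (cubeIndex s x) x :=
  le_max_of_le_right (by linarith [norm_sub_latticePt_cubeIndex_le s x])

theorem norm_sub_latticePt_le_of_bump_ne_zero {s : ℝ} {k : Fin d → ℤ} {x : 𝔼}
    (h : bump s k x ≠ 0) : ‖s⁻¹ • x - latticePt k‖ ≤ d + 1 := by
  by_contra! hlt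
  exact h (max_eq_left (by linarith))

theorem abs_bump_sub_bump_le {s : ℝ} (hs : 0 < s) (k : Fin d → ℤ) (x y : 𝔼) :
    |bump s k x - bump s k y| ≤ min (d + 1 : ℝ) (‖x - y‖ / s) := by
  refine le_min ?_ ?_
  · exact abs_sub_le_of_nonneg_of_le (bump_nonneg ..) (bump_le ..) (bump_nonneg ..) (bump_le ..)
  · refine (abs_max_sub_max_le_max _ _ _ _).trans ?_
    rw [sub_self, abs_zero, max_eq_right (abs_nonneg _), sub_sub_sub_cancel_left, abs_sub_comm]
    refine (abs_norm_sub_norm_le _ _).trans ?_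
    rw [sub_sub_sub_cancel_right, ← smul_sub, norm_smul, Real.norm_eq_abs,
      abs_of_pos (inv_pos.2 hs), div_eq_inv_mul]

/-- An upper bound for the number of points of `ℤ^d` in a ball of radius `2d + 2`. -/
def latticeBound (d : ℕ) : ℕ := (4 * d + 6) ^ d

theorem tsum_indicator_latticePt_le {r : ℝ} (hr : r ≤ 2 * d + 2) (x : 𝔼) :
    ∑' k : Fin d → ℤ, (Metric.closedBall (latticePt k) r).indicator 1 x
      ≤ (latticeBound d : ℝ≥0∞) := by
  classical
  set S : Finset (Fin d → ℤ) :=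
    Fintype.piFinset fun i => Finset.Icc (⌊x i⌋ - (2 * d + 2)) (⌊x i⌋ + (2 * d + 3)) with hS
  have hmem (k : Fin d → ℤ) (hk : k ∉ S) :
      (Metric.closedBall (latticePt k) r).indicator (1 : 𝔼 → ℝ≥0∞) x = 0 := by
    refine Set.indicator_of_notMem (fun h => hk ?_) _
    rw [hS, Fintype.mem_piFinset]
    intro i
    have h1 : |x i - k i| ≤ 2 * d + 2 :=
      ((PiLp.norm_apply_le (x - latticePt k) i).trans (mem_closedBall_iff_norm.1 h)).trans hr
    rw [abs_le] at h1
    have h2 := Int.floor_le (x i)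
    have h3 := Int.lt_floor_add_one (x i)
    rw [Finset.mem_Icc]
    constructor
    · have : (⌊x i⌋ : ℝ) - (2 * d + 2) ≤ k i := by linarith
      exact_mod_cast this
    · have : (k i : ℝ) ≤ ⌊x i⌋ + (2 * d + 3) := by linarith
      exact_mod_cast this
  rw [tsum_eq_sum hmem]
  calc ∑ k ∈ S, (Metric.closedBall (latticePt k) r).indicator (1 : 𝔼 → ℝ≥0∞) x
      ≤ ∑ k ∈ S, 1 := Finset.sum_le_sum fun k _ => Set.indicator_le_self' (by simp) x
    _ = (S.card : ℝ≥0∞) := by simp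
    _ = latticeBound d := by
        rw [hS, Fintype.card_piFinset]
        have (i : Fin d) :
            (Finset.Icc (⌊x i⌋ - (2 * d + 2)) (⌊x i⌋ + (2 * d + 3))).card = 4 * d + 6 := by
          rw [Int.card_Icc]; omega
        simp [this, latticeBound]

/-- Counting points of a relatively separated set in a ball of radius `r`. -/
theorem tsum_indicator_closedBall_le {L : Set 𝔼} {R : ℕ} (hL : relSep L ≤ R) (r : ℝ) (t : 𝔼) :
    ∑' x : L, (Metric.closedBall (0 : 𝔼) r).indicator 1 ((x : 𝔼) - t) ≤
      R / volume (Metric.ball (0 : 𝔼) 1) * volume (Metric.closedBall (0 : 𝔼) (r + 1)) := by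
  rw [← lintegral_indicator_one measurableSet_closedBall]
  refine tsum_sub_right_le hL (fun z w hzw => ?_) t
  by_cases hz : z ∈ Metric.closedBall (0 : 𝔼) r
  · have : w ∈ Metric.closedBall (0 : 𝔼) (r + 1) := by
      rw [Metric.mem_closedBall] at hz ⊢
      linarith [dist_triangle w z 0, dist_comm w z]
    simp [hz, this]
  · simp [hz]

/-! ### Commutator kernels and their smallness at large scale -/

/-- The envelope of the commutator kernels between cubes whose indices differ by `m`. -/
noncomputable def commKernel (Θ : EuclideanSpace ℝ (Fin d) → ℝ) (s : ℝ) (m : Fin d → ℤ)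
    (z : EuclideanSpace ℝ (Fin d)) : ℝ≥0∞ :=
  ‖Θ z‖ₑ * ENNReal.ofReal (min (d + 1 : ℝ) (‖z‖ / s)) *
    ((Metric.closedBall (latticePt m) (2 * d + 1)).indicator 1 (0 : EuclideanSpace ℝ (Fin d)) +
      (Metric.closedBall (latticePt m) (2 * d + 1)).indicator 1 (s⁻¹ • z))

/-- A majorant of `commKernel` on balls of radius `1`. -/
noncomputable def commMajorant (Θ : EuclideanSpace ℝ (Fin d) → ℝ) (s : ℝ) (m : Fin d → ℤ)
    (w : EuclideanSpace ℝ (Fin d)) : ℝ≥0∞ :=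
  localSup Θ w * ENNReal.ofReal (min (d + 1 : ℝ) ((‖w‖ + 1) / s)) *
    ((Metric.closedBall (latticePt m) (2 * d + 2)).indicator 1 (0 : EuclideanSpace ℝ (Fin d)) +
      (Metric.closedBall (latticePt m) (2 * d + 2)).indicator 1 (s⁻¹ • w))

/-- As `s ≥ 1`, moving `z` by less than `1` moves `s⁻¹ • z` by at most `1`; this accounts for the
radius growing from `2d + 1` to `2d + 2`. -/
theorem commKernel_le_commMajorant (Θ : 𝔼 → ℝ) {s : ℝ} (hs : 1 ≤ s) (m : Fin d → ℤ) {z w : 𝔼}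
    (hzw : dist z w < 1) : commKernel Θ s m z ≤ commMajorant Θ s m w := by
  have hs0 : 0 < s := by linarith
  have h1 : ‖z‖ ≤ ‖w‖ + 1 := by
    rw [dist_eq_norm] at hzw; linarith [norm_le_norm_add_norm_sub' z w]
  have hmono (u : 𝔼) (v : 𝔼) (huv : dist u v ≤ 1) :
      (Metric.closedBall (latticePt m) (2 * d + 1)).indicator (1 : 𝔼 → ℝ≥0∞) u ≤
        (Metric.closedBall (latticePt m) (2 * d + 2)).indicator 1 v := by
    by_cases hu : u ∈ Metric.closedBall (latticePt m : 𝔼) (2 * d + 1)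
    · have : v ∈ Metric.closedBall (latticePt m : 𝔼) (2 * d + 2) := by
        rw [Metric.mem_closedBall] at hu ⊢
        linarith [dist_triangle v u (latticePt m), dist_comm u v]
      simp [hu, this]
    · simp [hu]
  unfold commKernel commMajorant
  refine mul_le_mul' (by gcongr; exact enorm_le_localSup Θ hzw)
    (add_le_add (hmono 0 0 (by simp)) (hmono _ _ ?_))
  rw [dist_smul₀, Real.norm_eq_abs, abs_of_pos (inv_pos.2 hs0)]
  exact mul_le_one₀ (inv_le_one_of_one_le₀ hs) dist_nonneg hzw.le

/-- The difference vanishes unless one bump is nonzero. With `m = k - cubeIndex s y`, a nonzero bump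
at `x` puts `s⁻¹ • (x - y)` within `(d + 1) + d` of `m`, while a nonzero bump at `y` puts `0` there.
These are the two indicators in `commKernel`. -/
theorem enorm_mul_bump_sub_le_commKernel (Θ : 𝔼 → ℝ) {s : ℝ} (hs : 0 < s) (k : Fin d → ℤ)
    (x y : 𝔼) :
    ‖Θ (x - y)‖ₑ * ‖bump s k x - bump s k y‖ₑ ≤ commKernel Θ s (k - cubeIndex s y) (x - y) := by
  by_cases h0 : bump s k x = 0 ∧ bump s k y = 0
  · simp [h0.1, h0.2]
  have hy := norm_sub_latticePt_cubeIndex_le s y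
  have hone : (1 : ℝ≥0∞) ≤
      (Metric.closedBall (latticePt (k - cubeIndex s y)) (2 * d + 1)).indicator 1 (0 : 𝔼) +
      (Metric.closedBall (latticePt (k - cubeIndex s y)) (2 * d + 1)).indicator 1
        (s⁻¹ • (x - y)) := by
    rcases not_and_or.1 h0 with h | h
    · refine le_add_left ?_
      rw [Set.indicator_of_mem]
      · simp
      rw [mem_closedBall_iff_norm, latticePt_sub]
      have := norm_sub_latticePt_le_of_bump_ne_zero h
      calc ‖s⁻¹ • (x - y) - (latticePt k - latticePt (cubeIndex s y))‖
          = ‖(s⁻¹ • x - latticePt k) - (s⁻¹ • y - latticePt (cubeIndex s y))‖ := by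
            congr 1; rw [smul_sub]; abel
        _ ≤ 2 * d + 1 := (norm_sub_le _ _).trans (by linarith)
    · refine le_add_right ?_
      rw [Set.indicator_of_mem]
      · simp
      rw [mem_closedBall_iff_norm, latticePt_sub]
      have := norm_sub_latticePt_le_of_bump_ne_zero h
      calc ‖0 - (latticePt k - latticePt (cubeIndex s y))‖
          = ‖(s⁻¹ • y - latticePt k) - (s⁻¹ • y - latticePt (cubeIndex s y))‖ := by
            rw [zero_sub, norm_neg, sub_sub_sub_cancel_left, norm_sub_rev]
        _ ≤ 2 * d + 1 := (norm_sub_le _ _).trans (by linarith)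
  unfold commKernel
  refine le_trans ?_ (mul_le_mul_right hone _)
  rw [mul_one, ← ofReal_norm (bump s k x - bump s k y)]
  gcongr
  exact abs_bump_sub_bump_le hs k x y

/-- For fixed `w`, each of the two indicators is nonzero for at most `latticeBound d` indices `m`,
uniformly in `s`. Summing over `m` therefore does not spoil the decay in `s`. -/
theorem tsum_lintegral_commMajorant_le (Θ : 𝔼 → ℝ) (s : ℝ) :
    ∑' m, ∫⁻ w, commMajorant Θ s m w ≤ 2 * latticeBound d *
      ∫⁻ w, localSup Θ w * ENNReal.ofReal (min (d + 1 : ℝ) ((‖w‖ + 1) / s)) := by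
  have hmeas : Measurable fun w : 𝔼 =>
      localSup Θ w * ENNReal.ofReal (min (d + 1 : ℝ) ((‖w‖ + 1) / s)) :=
    (measurable_localSup Θ).mul (by fun_prop)
  rw [← lintegral_tsum, ← lintegral_const_mul _ hmeas]
  · refine lintegral_mono fun w => ?_
    simp only [commMajorant]
    rw [ENNReal.tsum_mul_left, ENNReal.tsum_add, mul_comm]
    gcongr
    rw [two_mul (latticeBound d : ℝ≥0∞)]
    exact add_le_add (tsum_indicator_latticePt_le le_rfl _) (tsum_indicator_latticePt_le le_rfl _)
  · intro m
    refine (hmeas.mul (measurable_const.add ?_)).aemeasurable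
    exact (measurable_one.indicator measurableSet_closedBall).comp (measurable_const_smul _)

/-- Dominated convergence: the cap `d + 1` in the minimum supplies an integrable majorant, so no
moment of `Θ` is needed. -/
theorem exists_scale_lintegral_le {Θ : 𝔼 → ℝ} (hΘ : MemAmalgamC0L1 Θ) {ε : ℝ≥0∞} (hε : 0 < ε) :
    ∃ s : ℝ, 1 ≤ s ∧
      ∫⁻ w, localSup Θ w * ENNReal.ofReal (min (d + 1 : ℝ) ((‖w‖ + 1) / s)) ≤ ε := by
  have hfin := lintegral_localSup_lt_top hΘ
  have hae : ∀ᵐ w, localSup Θ w < ∞ := ae_lt_top (measurable_localSup Θ) hfin.ne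
  have hlim := tendsto_lintegral_of_dominated_convergence (μ := (volume : Measure 𝔼))
    (F := fun (n : ℕ) w =>
      localSup Θ w * ENNReal.ofReal (min (d + 1 : ℝ) ((‖w‖ + 1) / ((n : ℝ) + 1))))
    (f := fun _ => 0)
    (fun w => localSup Θ w * ENNReal.ofReal (d + 1))
    (fun n => (measurable_localSup Θ).mul (by fun_prop))
    (fun n => Filter.Eventually.of_forall fun w => by
      dsimp only; gcongr; exact min_le_left _ _)
    (by rw [lintegral_mul_const _ (measurable_localSup Θ)]
        exact (ENNReal.mul_lt_top hfin ENNReal.ofReal_lt_top).ne)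
    (by
      filter_upwards [hae] with w hw
      have h1 : Filter.Tendsto (fun n : ℕ => (‖w‖ + 1) / ((n : ℝ) + 1)) Filter.atTop (nhds 0) :=
        tendsto_const_nhds.div_atTop
          (Filter.tendsto_atTop_add_const_right _ _ tendsto_natCast_atTop_atTop)
      have h2 := (tendsto_const_nhds (x := (d + 1 : ℝ))).min h1
      rw [min_eq_right (by positivity)] at h2
      have h3 := ENNReal.Tendsto.const_mul (ENNReal.tendsto_ofReal h2)
        (Or.inr hw.ne : _ ∨ localSup Θ w ≠ ∞)
      simpa using h3)
  rw [lintegral_zero] at hlim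
  obtain ⟨n, hn⟩ := (hlim.eventually (ge_mem_nhds hε)).exists
  exact ⟨n + 1, by simp, hn⟩

end geometry

/-! ### Matrices acting on sequences -/

section matrices
variable {X Y : Type*} {p : ℝ≥0∞}

theorem isMatrixImage_opMatrix (T : Ell 2 Y →L[ℂ] Ell 2 X) (c : Ell 2 Y) :
    IsMatrixImage (opMatrix T) c (T c) := by
  classical
  intro i
  have h1 : HasSum (fun j => lp.single 2 j (c j)) c := lp.hasSum_single (by simp) c
  have h2 := (h1.mapL T).mapL (lp.evalCLM ℂ (fun _ : X => ℂ) 2 i)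
  refine h2.congr_fun fun j => ?_
  have : (lp.single 2 j (c j) : Ell 2 Y) = c j • lp.single 2 j (1 : ℂ) := by
    rw [← lp.single_smul, smul_eq_mul, mul_one]
  rw [this, map_smul, map_smul, smul_eq_mul, mul_comm, opMatrix]
  congr!

/-- Records `P² = P` entrywise, a form that can be used on every `ℓ^q`. -/
theorem isMatrixImage_col_of_comp_self {P : Ell 2 X →L[ℂ] Ell 2 X} (hP : P ∘L P = P) (z : X) :
    IsMatrixImage (opMatrix P) (fun y => opMatrix P y z) (fun y => opMatrix P y z) := by
  classical
  have h := isMatrixImage_opMatrix P (P (lp.single 2 z (1 : ℂ)))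
  rw [← ContinuousLinearMap.comp_apply, hP] at h
  unfold opMatrix at h ⊢
  convert h

/-- The row and column sums of the absolute values of `M` are at most `S`. -/
structure SchurBound (M : Matrix X Y ℂ) (S : ℝ≥0∞) : Prop where
  row : ∀ x, ∑' y, ‖M x y‖ₑ ≤ S
  col : ∀ y, ∑' x, ‖M x y‖ₑ ≤ S

theorem SchurBound.lpn_le {M : Matrix X Y ℂ} {S : ℝ≥0∞} (hM : SchurBound M S) (hp : 1 ≤ p)
    (f : Y → ℝ≥0∞) : lpn p (fun x => ∑' y, ‖M x y‖ₑ * f y) ≤ S * lpn p f :=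
  lpn_kernel_le hp hM.row hM.col f

theorem SchurBound.tsum_lt_top {M : Matrix X Y ℂ} {S : ℝ≥0∞} (hM : SchurBound M S) (hS : S < ∞)
    (hp : 1 ≤ p) {f : Y → ℝ≥0∞} (hf : lpn p f < ∞) (x : X) : ∑' y, ‖M x y‖ₑ * f y < ∞ :=
  ((le_lpn hp (fun x => ∑' y, ‖M x y‖ₑ * f y) x).trans (hM.lpn_le hp f)).trans_lt
    (ENNReal.mul_lt_top hS hf)

theorem lpn_ell_lt_top (hp : 1 ≤ p) (u : Ell p X) : lpn p (fun x => ‖u x‖ₑ) < ∞ := by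
  rw [← ofReal_norm_eq_lpn hp]; exact ENNReal.ofReal_lt_top

theorem SchurBound.actsOnEll {M : Matrix X Y ℂ} {S : ℝ≥0∞} (hM : SchurBound M S) (hS : S < ∞)
    (hp : 1 ≤ p) : ActsOnEll M p := by
  intro c
  have hc := lpn_ell_lt_top hp c
  have hle (x : X) : ‖∑' y, M x y * c y‖ₑ ≤ ∑' y, ‖M x y‖ₑ * ‖c y‖ₑ := by
    simpa only [enorm_mul] using enorm_tsum_le_tsum_enorm (f := fun y => M x y * c y)
  have hfin : lpn p (fun x => ‖∑' y, M x y * c y‖ₑ) < ∞ :=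
    ((lpn_mono hp hle).trans (hM.lpn_le hp _)).trans_lt (ENNReal.mul_lt_top hS hc)
  refine ⟨⟨_, memℓp_of_lpn_lt_top hp hfin⟩, fun x => (Summable.of_enorm ?_).hasSum⟩
  simpa only [enorm_mul] using (hM.tsum_lt_top hS hp hc x).ne

/-- An idempotent matrix fixes its images. -/
theorem SchurBound.isMatrixImage_self {P : Matrix X X ℂ} {S : ℝ≥0∞} (hM : SchurBound P S)
    (hS : S < ∞) (hP : ∀ z, IsMatrixImage P (fun y => P y z) (fun y => P y z)) (hp : 1 ≤ p)
    {c u : X → ℂ} (hc : lpn p (fun x => ‖c x‖ₑ) < ∞) (hu : IsMatrixImage P c u) :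
    IsMatrixImage P u u := by
  intro x
  -- Absolute summability of the double series, from Schur's test applied twice, justifies
  -- interchanging the sums in `P(Pc) = (PP)c`.
  have hsum : Summable fun a : X × X => P x a.1 * (P a.1 a.2 * c a.2) := by
    refine Summable.of_enorm ?_
    refine ne_of_eq_of_ne (ENNReal.tsum_prod (f := fun y z => ‖P x y * (P y z * c z)‖ₑ)) ?_
    simp only [enorm_mul, ENNReal.tsum_mul_left]
    exact (hM.tsum_lt_top hS hp ((hM.lpn_le hp _).trans_lt (ENNReal.mul_lt_top hS hc)) x).ne
  obtain ⟨a, ha⟩ := hsum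
  have h1 : HasSum (fun y => P x y * u y) a :=
    ha.prod_fiberwise fun y => (hu y).mul_left (P x y)
  have h2 : HasSum (fun z => P x z * c z) a := by
    refine HasSum.prod_fiberwise ((Equiv.prodComm X X).hasSum_iff.2 ha) fun z => ?_
    exact ((hP z x).mul_right (c z)).congr_fun fun y => by simp [mul_assoc]
  rwa [h2.unique (hu x)] at h1

theorem enorm_image_sub_le {M : Matrix X Y ℂ} {c c' : Y → ℂ} {v w' : X → ℂ}
    (hw : IsMatrixImage M c v) (hw' : IsMatrixImage M c' w') (x : X) :
    ‖w' x - v x‖ₑ ≤ ∑' y, ‖M x y‖ₑ * ‖c' y - c y‖ₑ := by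
  have h := (hw' x).sub (hw x)
  rw [← h.tsum_eq]
  refine enorm_tsum_le_tsum_enorm.trans_eq (tsum_congr fun y => ?_)
  rw [← mul_sub, enorm_mul]

/-- The left side is `M ψ c - φ M c`, the action of a matrix with entries `M x y * (ψ y - φ x)`. -/
theorem enorm_commutator_le {M : Matrix X Y ℂ} {c : Y → ℂ} {v w : X → ℂ} (φ : X → ℝ) (ψ : Y → ℝ)
    (hv : IsMatrixImage M c v) (hw : IsMatrixImage M (fun y => ψ y * c y) w) (x : X) :
    ‖w x - φ x * v x‖ₑ ≤ ∑' y, ‖M x y‖ₑ * ‖φ x - ψ y‖ₑ * ‖c y‖ₑ := by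
  have h := (hw x).sub ((hv x).mul_left (φ x : ℂ))
  rw [← h.tsum_eq]
  refine enorm_tsum_le_tsum_enorm.trans_eq (tsum_congr fun y => ?_)
  have : M x y * (ψ y * c y) - φ x * (M x y * c y) = -(M x y * ((φ x - ψ y : ℝ) : ℂ) * c y) := by
    push_cast; ring
  rw [this, enorm_neg, enorm_mul, enorm_mul]
  congr 2
  rw [← ofReal_norm, Complex.norm_real, ofReal_norm]

end matrices

/-! ### Schur bounds for commutators; comparing `ℓ^q` with norms over cubes -/

section commutators
variable {d : ℕ} {p : ℝ≥0∞}

local notation "𝔼" => EuclideanSpace ℝ (Fin d)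

/-- The bound for row and column sums given by the envelope `Θ`. -/
noncomputable def envelopeBound (Θ : EuclideanSpace ℝ (Fin d) → ℝ) (R : ℕ) : ℝ≥0∞ :=
  R / volume (Metric.ball (0 : EuclideanSpace ℝ (Fin d)) 1) * ∫⁻ w, localSup Θ w

theorem natCast_div_volume_ball_lt_top (R : ℕ) :
    (R : ℝ≥0∞) / volume (Metric.ball (0 : 𝔼) 1) < ∞ :=
  ENNReal.div_lt_top (by simp) (Metric.measure_ball_pos _ _ one_pos).ne'

theorem envelopeBound_lt_top {Θ : 𝔼 → ℝ} (hΘ : MemAmalgamC0L1 Θ) (R : ℕ) :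
    envelopeBound Θ R < ∞ :=
  ENNReal.mul_lt_top (natCast_div_volume_ball_lt_top R) (lintegral_localSup_lt_top hΘ)

theorem enorm_le_enorm_of_norm_le {z : ℂ} {t : ℝ} (h : ‖z‖ ≤ t) : ‖z‖ₑ ≤ ‖t‖ₑ := by
  rw [← ofReal_norm, ← ofReal_norm]
  exact ENNReal.ofReal_le_ofReal (h.trans (le_abs_self t))

theorem schurBound_of_envelope {L G : Set 𝔼} {R : ℕ} (hL : relSep L ≤ R) (hG : relSep G ≤ R)
    {Θ : 𝔼 → ℝ} {M : Matrix L G ℂ} (hM : ∀ (l : L) (g : G), ‖M l g‖ ≤ Θ ((l : 𝔼) - g)) :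
    SchurBound M (envelopeBound Θ R) where
  row l := (ENNReal.tsum_le_tsum fun g => enorm_le_enorm_of_norm_le (hM l g)).trans
    (tsum_sub_left_le (H := fun z => ‖Θ z‖ₑ) hG (fun _ _ h => enorm_le_localSup Θ h) l)
  col g := (ENNReal.tsum_le_tsum fun l => enorm_le_enorm_of_norm_le (hM l g)).trans
    (tsum_sub_right_le (H := fun z => ‖Θ z‖ₑ) hL (fun _ _ h => enorm_le_localSup Θ h) g)

/-- The bound for the commutator kernels between cubes whose indices differ by `m`. -/
noncomputable def commBound (Θ : EuclideanSpace ℝ (Fin d) → ℝ) (R : ℕ) (s : ℝ)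
    (m : Fin d → ℤ) : ℝ≥0∞ :=
  R / volume (Metric.ball (0 : EuclideanSpace ℝ (Fin d)) 1) * ∫⁻ w, commMajorant Θ s m w

theorem exists_scale_tsum_commBound_le {Θ : 𝔼 → ℝ} (hΘ : MemAmalgamC0L1 Θ) (R : ℕ) {ε : ℝ≥0∞}
    (hε : 0 < ε) : ∃ s : ℝ, 1 ≤ s ∧ ∑' m, commBound Θ R s m ≤ ε := by
  set a : ℝ≥0∞ := R / volume (Metric.ball (0 : 𝔼) 1) * (2 * latticeBound d)
  have ha : a ≠ ∞ := ENNReal.mul_ne_top (natCast_div_volume_ball_lt_top R).ne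
    (ENNReal.mul_ne_top (by simp) (by simp))
  obtain ⟨s, hs, h⟩ := exists_scale_lintegral_le hΘ (ENNReal.div_pos hε.ne' ha)
  refine ⟨s, hs, ?_⟩
  simp only [commBound]
  rw [ENNReal.tsum_mul_left]
  calc _ ≤ R / volume (Metric.ball (0 : 𝔼) 1) * (2 * latticeBound d * (ε / a)) := by
        gcongr
        exact (tsum_lintegral_commMajorant_le Θ s).trans (by gcongr)
    _ = a * (ε / a) := by rw [← mul_assoc]
    _ ≤ ε := ENNReal.mul_div_le

/-- The restriction of `f` to the cube with index `j`. -/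
noncomputable def cubePart {G : Set (EuclideanSpace ℝ (Fin d))} (s : ℝ) (j : Fin d → ℤ)
    (f : G → ℝ≥0∞) (y : G) : ℝ≥0∞ :=
  if cubeIndex s (y : EuclideanSpace ℝ (Fin d)) = j then f y else 0

theorem tsum_cubePart {G : Set 𝔼} (s : ℝ) (f : G → ℝ≥0∞) (y : G) :
    ∑' j, cubePart s j f y = f y := by
  simp [cubePart]

/-- Splitting `f` over cubes bounds the kernel on cube `j` by a function of `l - g` that depends on
`k - j` only; Minkowski's inequality in `j` and Schur's test finish. -/
theorem lpn_commutator_le {L G : Set 𝔼} {R : ℕ} (hL : relSep L ≤ R) (hG : relSep G ≤ R)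
    (Θ : 𝔼 → ℝ) {s : ℝ} (hs : 1 ≤ s) (hp : 1 ≤ p) (k : Fin d → ℤ) (f : G → ℝ≥0∞) :
    lpn p (fun l : L => ∑' g : G, ‖Θ ((l : 𝔼) - g)‖ₑ * ‖bump s k (l : 𝔼) - bump s k (g : 𝔼)‖ₑ * f g)
      ≤ ∑' j, commBound Θ R s (k - j) * lpn p (cubePart s j f) := by
  have hpoint (l : L) :
      ∑' g : G, ‖Θ ((l : 𝔼) - g)‖ₑ * ‖bump s k (l : 𝔼) - bump s k (g : 𝔼)‖ₑ * f g ≤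
        ∑' j, ∑' g : G, commKernel Θ s (k - j) ((l : 𝔼) - g) * cubePart s j f g := by
    rw [ENNReal.tsum_comm]
    refine ENNReal.tsum_le_tsum fun g => ?_
    rw [← tsum_cubePart s f g, ← ENNReal.tsum_mul_left]
    refine ENNReal.tsum_le_tsum fun j => ?_
    by_cases hj : cubeIndex s (g : 𝔼) = j
    · subst hj
      gcongr
      exact enorm_mul_bump_sub_le_commKernel Θ (by linarith) k l g
    · simp [cubePart, hj]
  refine (lpn_mono hp hpoint).trans ((lpn_tsum_le hp _).trans
    (ENNReal.tsum_le_tsum fun j => lpn_kernel_le hp (fun l => ?_) (fun g => ?_) _))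
  · exact tsum_sub_left_le hG (fun _ _ h => commKernel_le_commMajorant Θ hs _ h) l
  · exact tsum_sub_right_le hL (fun _ _ h => commKernel_le_commMajorant Θ hs _ h) g

/-- The Schur bound for the kernel `bump s k x`. -/
noncomputable def bumpBound (d R : ℕ) (s : ℝ) : ℝ≥0∞ :=
  ENNReal.ofReal (d + 1) * (R / volume (Metric.ball (0 : EuclideanSpace ℝ (Fin d)) 1) *
    volume (Metric.closedBall (0 : EuclideanSpace ℝ (Fin d)) (s * (d + 1) + 1)) +
      (latticeBound d + 1 : ℕ))

theorem bumpBound_lt_top (d R : ℕ) (s : ℝ) : bumpBound d R s < ∞ :=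
  ENNReal.mul_lt_top ENNReal.ofReal_lt_top (ENNReal.add_lt_top.2
    ⟨ENNReal.mul_lt_top (natCast_div_volume_ball_lt_top R) measure_closedBall_lt_top, by simp⟩)

theorem bumpBound_pos (d R : ℕ) (s : ℝ) : 0 < bumpBound d R s := by
  refine ENNReal.mul_pos (by simp; positivity) (by simp)

theorem enorm_bump_le_indicator (s : ℝ) (k : Fin d → ℤ) (x : 𝔼) :
    ‖bump s k x‖ₑ ≤ ENNReal.ofReal (d + 1) *
      (Metric.closedBall (latticePt k) (d + 1)).indicator 1 (s⁻¹ • x) := by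
  by_cases h : bump s k x = 0
  · simp [h]
  rw [Set.indicator_of_mem]
  · rw [Pi.one_apply, mul_one, ← ofReal_norm, Real.norm_of_nonneg (bump_nonneg ..)]
    exact ENNReal.ofReal_le_ofReal (bump_le ..)
  · exact mem_closedBall_iff_norm.2 (norm_sub_latticePt_le_of_bump_ne_zero h)

theorem tsum_enorm_bump_index_le (R : ℕ) (s : ℝ) (x : 𝔼) :
    ∑' k, ‖bump s k x‖ₑ ≤ bumpBound d R s := by
  refine (ENNReal.tsum_le_tsum fun k => enorm_bump_le_indicator s k x).trans ?_
  rw [ENNReal.tsum_mul_left]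
  unfold bumpBound
  gcongr
  refine (tsum_indicator_latticePt_le (by linarith [(Nat.cast_nonneg d : (0 : ℝ) ≤ d)]) _).trans ?_
  push_cast
  exact le_add_left le_self_add

theorem tsum_enorm_bump_le {L : Set 𝔼} {R : ℕ} (hL : relSep L ≤ R) {s : ℝ} (hs : 0 < s)
    (k : Fin d → ℤ) : ∑' x : L, ‖bump s k (x : 𝔼)‖ₑ ≤ bumpBound d R s := by
  refine (ENNReal.tsum_le_tsum fun x : L => enorm_bump_le_indicator s k x).trans ?_
  rw [ENNReal.tsum_mul_left]
  unfold bumpBound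
  gcongr
  refine le_add_right (le_trans (ENNReal.tsum_le_tsum fun x => ?_)
    (tsum_indicator_closedBall_le hL (s * (d + 1)) (s • latticePt k)))
  by_cases h : s⁻¹ • (x : 𝔼) ∈ Metric.closedBall (latticePt k) (d + 1)
  · rw [Set.indicator_of_mem h, Set.indicator_of_mem]
    · simp
    rw [mem_closedBall_zero_iff]
    rw [mem_closedBall_iff_norm] at h
    have : (x : 𝔼) - s • latticePt k = s • (s⁻¹ • (x : 𝔼) - latticePt k) := by
      rw [smul_sub, smul_inv_smul₀ hs.ne']
    rw [this, norm_smul, Real.norm_of_nonneg hs.le]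
    gcongr
  · simp [h]

theorem lpn_tsum_bump_le {L : Set 𝔼} {R : ℕ} (hL : relSep L ≤ R) {s : ℝ} (hs : 0 < s)
    (hp : 1 ≤ p) (f : L → ℝ≥0∞) :
    lpn p (fun k => ∑' x : L, ‖bump s k (x : 𝔼)‖ₑ * f x) ≤ bumpBound d R s * lpn p f := by
  refine lpn_kernel_le hp (fun k => ?_) (fun x => ?_) f
  · exact tsum_enorm_bump_le hL hs k
  · exact tsum_enorm_bump_index_le R s (x : 𝔼)

theorem lpn_tsum_bump_index_le {L : Set 𝔼} {R : ℕ} (hL : relSep L ≤ R) {s : ℝ} (hs : 0 < s)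
    (hp : 1 ≤ p) (g : (Fin d → ℤ) → ℝ≥0∞) :
    lpn p (fun x : L => ∑' k, ‖bump s k (x : 𝔼)‖ₑ * g k) ≤ bumpBound d R s * lpn p g := by
  refine lpn_kernel_le hp (fun x => ?_) (fun k => ?_) g
  · exact tsum_enorm_bump_index_le R s (x : 𝔼)
  · exact tsum_enorm_bump_le hL hs k

theorem cubePart_le_bump_mul {L : Set 𝔼} (s : ℝ) (k : Fin d → ℤ) (f : L → ℝ≥0∞) (x : L) :
    cubePart s k f x ≤ ‖bump s k (x : 𝔼)‖ₑ * f x := by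
  by_cases h : cubeIndex s (x : 𝔼) = k
  · subst h
    have : (1 : ℝ≥0∞) ≤ ‖bump s (cubeIndex s (x : 𝔼)) (x : 𝔼)‖ₑ := by
      rw [← ofReal_norm, Real.norm_of_nonneg (bump_nonneg ..), ENNReal.one_le_ofReal]
      exact one_le_bump s (x : 𝔼)
    simpa [cubePart] using mul_le_mul_left this (f x)
  · simp [cubePart, h]

/-- The `ℓ^p` norm on a cube is at most the `ℓ^1` norm weighted by the bump, so Schur's test for the
kernel `bump s k x` gives a constant free of `p` and `q`. -/
theorem lpn_lpn_cubePart_le {L : Set 𝔼} {R : ℕ} (hL : relSep L ≤ R) {s : ℝ} (hs : 0 < s)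
    {q : ℝ≥0∞} (hp : 1 ≤ p) (hq : 1 ≤ q) (f : L → ℝ≥0∞) :
    lpn q (fun k => lpn p (cubePart s k f)) ≤ bumpBound d R s * lpn q f :=
  (lpn_mono hq fun k => (lpn_mono hp (cubePart_le_bump_mul s k f)).trans
    (lpn_le_tsum hp _)).trans (lpn_tsum_bump_le hL hs hq f)

/-- Each value is at most the `ℓ^p` norm over its own cube, whose bump is at least `1` there. -/
theorem lpn_le_lpn_lpn_cubePart {L : Set 𝔼} {R : ℕ} (hL : relSep L ≤ R) {s : ℝ} (hs : 0 < s)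
    {q : ℝ≥0∞} (hp : 1 ≤ p) (hq : 1 ≤ q) (f : L → ℝ≥0∞) :
    lpn q f ≤ bumpBound d R s * lpn q (fun k => lpn p (cubePart s k f)) := by
  refine (lpn_mono hq fun x => ?_).trans (lpn_tsum_bump_index_le hL hs hq _)
  rw [← tsum_cubePart s f x]
  refine ENNReal.tsum_le_tsum fun k => ?_
  by_cases h : cubeIndex s (x : 𝔼) = k
  · subst h
    have : (1 : ℝ≥0∞) ≤ ‖bump s (cubeIndex s (x : 𝔼)) (x : 𝔼)‖ₑ := by
      rw [← ofReal_norm, Real.norm_of_nonneg (bump_nonneg ..), ENNReal.one_le_ofReal]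
      exact one_le_bump s (x : 𝔼)
    exact (le_lpn hp _ x).trans (le_mul_of_one_le_left zero_le this)
  · simp [cubePart, h]

end commutators

/-! ### The local estimate and its summation -/

section stability
variable {d : ℕ} {p q : ℝ≥0∞}

local notation "𝔼" => EuclideanSpace ℝ (Fin d)

theorem enorm_le_enorm_add {a b : ℂ} {e : ℝ≥0∞} (h : ‖a - b‖ₑ ≤ e) : ‖a‖ₑ ≤ ‖b‖ₑ + e := by
  calc ‖a‖ₑ = ‖b + (a - b)‖ₑ := by rw [add_sub_cancel]
    _ ≤ ‖b‖ₑ + e := (enorm_add_le _ _).trans (by gcongr)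

theorem enorm_sub_comm (a b : ℂ) : ‖a - b‖ₑ = ‖b - a‖ₑ := by
  rw [← enorm_neg, neg_sub]

/-- With `w = P φ_k u`, `w' = A w` and `w'' = A φ_k u`, one has `w - φ_k u = [P, φ_k] u` (as `Pu =
u`), `w'' - φ_k v = [A, φ_k] u` and `w' - w'' = A [P, φ_k] u`. In the factor of the error, `1` comes
from `[A, φ_k]`, the envelope bound from `A [P, φ_k]`, and `C` from replacing `φ_k u` by `w`. -/
theorem lpn_cubePart_le {L G : Set 𝔼} {R : ℕ} (hL : relSep L ≤ R) (hG : relSep G ≤ R) {Θ : 𝔼 → ℝ}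
    (hΘ : MemAmalgamC0L1 Θ) {s : ℝ} (hs : 1 ≤ s) {A : Matrix L G ℂ} {P : Matrix G G ℂ}
    (hA : ∀ (l : L) (g : G), ‖A l g‖ ≤ Θ ((l : 𝔼) - g))
    (hP : ∀ g g' : G, ‖P g g'‖ ≤ Θ ((g : 𝔼) - g')) (hp : 1 ≤ p) (hq : 1 ≤ q) {C : ℝ} (hC : 0 ≤ C)
    (hbelow : BoundedBelowOnRange A P p C) {u : G → ℂ} {v : L → ℂ}
    (hu : lpn q (fun g => ‖u g‖ₑ) < ∞) (hPu : IsMatrixImage P u u) (hAu : IsMatrixImage A u v)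
    (k : Fin d → ℤ) :
    ENNReal.ofReal C * lpn p (cubePart s k fun g => ‖u g‖ₑ) ≤
      ∑' l : L, ‖bump s k (l : 𝔼)‖ₑ * ‖v l‖ₑ + (1 + envelopeBound Θ R + ENNReal.ofReal C) *
        ∑' j, commBound Θ R s (k - j) * lpn p (cubePart s j fun g => ‖u g‖ₑ) := by
  have hS := envelopeBound_lt_top hΘ R
  have hAS := schurBound_of_envelope hL hG hA
  have hPS := schurBound_of_envelope hG hG hP
  have henorm (t : ℝ) : ‖(t : ℂ)‖ₑ = ‖t‖ₑ := by rw [← ofReal_norm, Complex.norm_real, ofReal_norm]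
  set S := envelopeBound Θ R
  set c := ENNReal.ofReal C
  set T := ∑' j, commBound Θ R s (k - j) * lpn p (cubePart s j fun g => ‖u g‖ₑ)
  -- Although `u` is only in `ℓ^q`, the localized sequence is in `ℓ^1`, hence in `ℓ^p`, so `hbelow`
  -- applies to it.
  have hfin : lpn p (fun g : G => ‖(bump s k (g : 𝔼) : ℂ) * u g‖ₑ) < ∞ := by
    refine (lpn_le_tsum hp _).trans_lt ?_
    simp only [enorm_mul, henorm]
    exact ((le_lpn hq (fun k => ∑' g : G, ‖bump s k (g : 𝔼)‖ₑ * ‖u g‖ₑ) k).trans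
      (lpn_tsum_bump_le hG (by linarith) hq _)).trans_lt
      (ENNReal.mul_lt_top (bumpBound_lt_top d R s) hu)
  let f : Ell p G := ⟨_, memℓp_of_lpn_lt_top hp hfin⟩
  obtain ⟨w, hw⟩ := hPS.actsOnEll hS hp f
  obtain ⟨w', hw'⟩ := hAS.actsOnEll hS hp w
  obtain ⟨w'', hw''⟩ := hAS.actsOnEll hS hp f
  have hcw : c * lpn p (fun g => ‖w g‖ₑ) ≤ lpn p (fun l => ‖w' l‖ₑ) := by
    rw [← ofReal_norm_eq_lpn hp, ← ofReal_norm_eq_lpn hp, ← ENNReal.ofReal_mul hC]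
    exact ENNReal.ofReal_le_ofReal (hbelow f w w' hw hw')
  let E (y : G) : ℝ≥0∞ :=
    ∑' g : G, ‖Θ ((y : 𝔼) - g)‖ₑ * ‖bump s k (y : 𝔼) - bump s k (g : 𝔼)‖ₑ * ‖u g‖ₑ
  let F (l : L) : ℝ≥0∞ :=
    ∑' g : G, ‖Θ ((l : 𝔼) - g)‖ₑ * ‖bump s k (l : 𝔼) - bump s k (g : 𝔼)‖ₑ * ‖u g‖ₑ
  have hE : lpn p E ≤ T := lpn_commutator_le hG hG Θ hs hp k _
  have hF : lpn p F ≤ T := lpn_commutator_le hL hG Θ hs hp k _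
  have h1 (y : G) : ‖w y - bump s k (y : 𝔼) * u y‖ₑ ≤ E y := by
    refine (enorm_commutator_le (fun y : G => bump s k (y : 𝔼)) (fun y : G => bump s k (y : 𝔼))
      hPu hw y).trans (ENNReal.tsum_le_tsum fun g => ?_)
    gcongr
    exact enorm_le_enorm_of_norm_le (hP y g)
  have h2 (l : L) : ‖w'' l - bump s k (l : 𝔼) * v l‖ₑ ≤ F l := by
    refine (enorm_commutator_le (fun y : L => bump s k (y : 𝔼)) (fun y : G => bump s k (y : 𝔼))
      hAu hw'' l).trans (ENNReal.tsum_le_tsum fun g => ?_)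
    gcongr
    exact enorm_le_enorm_of_norm_le (hA l g)
  have h3 (l : L) : ‖w' l - w'' l‖ₑ ≤ ∑' g, ‖A l g‖ₑ * E g :=
    (enorm_image_sub_le hw'' hw' l).trans (ENNReal.tsum_le_tsum fun g => by gcongr; exact h1 g)
  have hw'_le : lpn p (fun l => ‖w' l‖ₑ) ≤
      ∑' l : L, ‖bump s k (l : 𝔼)‖ₑ * ‖v l‖ₑ + T + S * T := by
    calc lpn p (fun l => ‖w' l‖ₑ)
        ≤ lpn p (fun l : L => ‖bump s k (l : 𝔼)‖ₑ * ‖v l‖ₑ + F l + ∑' g, ‖A l g‖ₑ * E g) := by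
          refine lpn_mono hp fun l => (enorm_le_enorm_add (h3 l)).trans ?_
          gcongr
          refine (enorm_le_enorm_add (h2 l)).trans ?_
          rw [enorm_mul, henorm]
      _ ≤ lpn p (fun l : L => ‖bump s k (l : 𝔼)‖ₑ * ‖v l‖ₑ) + lpn p F +
            lpn p (fun l => ∑' g, ‖A l g‖ₑ * E g) :=
          (lpn_add_le hp _ _).trans (by gcongr; exact lpn_add_le hp _ _)
      _ ≤ _ := by
          gcongr
          · exact lpn_le_tsum hp _
          · exact (hAS.lpn_le hp E).trans (by gcongr)
  have hcube : lpn p (cubePart s k fun g => ‖u g‖ₑ) ≤ lpn p (fun g => ‖w g‖ₑ) + T := by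
    calc lpn p (cubePart s k fun g => ‖u g‖ₑ) ≤ lpn p (fun g => ‖w g‖ₑ + E g) := by
          refine lpn_mono hp fun g => (cubePart_le_bump_mul s k _ g).trans ?_
          rw [← henorm, ← enorm_mul]
          exact enorm_le_enorm_add ((enorm_sub_comm _ _).trans_le (h1 g))
      _ ≤ _ := (lpn_add_le hp _ _).trans (by gcongr)
  calc c * lpn p (cubePart s k fun g => ‖u g‖ₑ) ≤ c * (lpn p (fun g => ‖w g‖ₑ) + T) := by gcongr
    _ = c * lpn p (fun g => ‖w g‖ₑ) + c * T := mul_add _ _ _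
    _ ≤ (∑' l : L, ‖bump s k (l : 𝔼)‖ₑ * ‖v l‖ₑ + T + S * T) + c * T := by
        gcongr; exact hcw.trans hw'_le
    _ = _ := by ring

theorem lpn_le_of_boundedBelowOnRange {L G : Set 𝔼} {R : ℕ} (hL : relSep L ≤ R)
    (hG : relSep G ≤ R) {Θ : 𝔼 → ℝ} (hΘ : MemAmalgamC0L1 Θ) {s : ℝ} (hs : 1 ≤ s)
    {A : Matrix L G ℂ} {P : Matrix G G ℂ} (hA : ∀ (l : L) (g : G), ‖A l g‖ ≤ Θ ((l : 𝔼) - g))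
    (hP : ∀ g g' : G, ‖P g g'‖ ≤ Θ ((g : 𝔼) - g')) (hp : 1 ≤ p) (hq : 1 ≤ q) {C : ℝ} (hC : 0 ≤ C)
    (hsmall : (1 + envelopeBound Θ R + ENNReal.ofReal C) * ∑' m, commBound Θ R s m ≤
      ENNReal.ofReal (C / 2))
    (hbelow : BoundedBelowOnRange A P p C) {u : G → ℂ} {v : L → ℂ}
    (hu : lpn q (fun g => ‖u g‖ₑ) < ∞) (hPu : IsMatrixImage P u u) (hAu : IsMatrixImage A u v) :
    ENNReal.ofReal (C / 2) * lpn q (fun g => ‖u g‖ₑ) ≤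
      bumpBound d R s ^ 2 * lpn q (fun l => ‖v l‖ₑ) := by
  have hs0 : 0 < s := by linarith
  set D := bumpBound d R s
  set a : (Fin d → ℤ) → ℝ≥0∞ := fun k => lpn p (cubePart s k fun g => ‖u g‖ₑ) with ha
  set K := 1 + envelopeBound Θ R + ENNReal.ofReal C
  set V := ∑' m, commBound Θ R s m
  have hafin : lpn q a < ∞ := (lpn_lpn_cubePart_le hG hs0 hp hq _).trans_lt
    (ENNReal.mul_lt_top (bumpBound_lt_top d R s) hu)
  have hconv : lpn q (fun k => ∑' j, commBound Θ R s (k - j) * a j) ≤ V * lpn q a := by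
    -- Young's inequality as a case of Schur's test: rows and columns of `β(k - j)` both sum to `V`.
    refine lpn_kernel_le hq (fun k => ?_) (fun j => ?_) a
    · exact ((Equiv.subLeft k).tsum_eq (commBound Θ R s)).le
    · exact ((Equiv.subRight j).tsum_eq (commBound Θ R s)).le
  have hmain : ENNReal.ofReal C * lpn q a ≤
      D * lpn q (fun l => ‖v l‖ₑ) + ENNReal.ofReal (C / 2) * lpn q a := by
    rw [← lpn_const_mul hq]
    refine (lpn_mono hq fun k =>
      lpn_cubePart_le hL hG hΘ hs hA hP hp hq hC hbelow hu hPu hAu k).trans ?_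
    refine (lpn_add_le hq _ _).trans (add_le_add (lpn_tsum_bump_le hL hs0 hq _) ?_)
    rw [lpn_const_mul hq]
    calc K * lpn q (fun k => ∑' j, commBound Θ R s (k - j) * a j) ≤ K * (V * lpn q a) := by gcongr
      _ = K * V * lpn q a := (mul_assoc _ _ _).symm
      _ ≤ _ := by gcongr
  have hhalf : ENNReal.ofReal (C / 2) * lpn q a ≤ D * lpn q (fun l => ‖v l‖ₑ) := by
    have hsplit : ENNReal.ofReal C = ENNReal.ofReal (C / 2) + ENNReal.ofReal (C / 2) := by
      rw [← ENNReal.ofReal_add (by linarith) (by linarith), add_halves]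
    rw [hsplit, add_mul] at hmain
    -- Absorption requires `lpn q a` to be finite, which is where `u ∈ ℓ^q` enters.
    exact (ENNReal.add_le_add_iff_right
      (ENNReal.mul_lt_top ENNReal.ofReal_lt_top hafin).ne).1 hmain
  calc ENNReal.ofReal (C / 2) * lpn q (fun g => ‖u g‖ₑ)
      ≤ ENNReal.ofReal (C / 2) * (D * lpn q a) := by
        gcongr; exact lpn_le_lpn_lpn_cubePart hG hs0 hp hq _
    _ = D * (ENNReal.ofReal (C / 2) * lpn q a) := by ring
    _ ≤ D * (D * lpn q (fun l => ‖v l‖ₑ)) := by gcongr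
    _ = D ^ 2 * lpn q (fun l => ‖v l‖ₑ) := by ring

end stability

theorem mainTheorem7 (d : ℕ) (Θ : EuclideanSpace ℝ (Fin d) → ℝ) (hΘ : MemAmalgamC0L1 Θ)
    (Cp : ℝ) (hCp : 0 < Cp) (RΛ RΓ : ℕ) :
    ∃ C' : ℝ, 0 < C' ∧
      ∀ (Λ Γ : Set (EuclideanSpace ℝ (Fin d))), relSep Λ ≤ RΛ → relSep Γ ≤ RΓ →
      ∀ (A : Ell 2 Γ →L[ℂ] Ell 2 Λ) (P : Ell 2 Γ →L[ℂ] Ell 2 Γ), P ∘L P = P →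
        (∀ (l : Λ) (g : Γ), ‖opMatrix A l g‖ ≤ Θ ((l : EuclideanSpace ℝ (Fin d)) - g)) →
        (∀ g g' : Γ, ‖opMatrix P g g'‖ ≤ Θ ((g : EuclideanSpace ℝ (Fin d)) - g')) →
        (∀ q : ℝ≥0∞, 1 ≤ q → ActsOnEll (opMatrix P) q ∧ ActsOnEll (opMatrix A) q) ∧
        ∀ p : ℝ≥0∞, 1 ≤ p → BoundedBelowOnRange (opMatrix A) (opMatrix P) p Cp →
          ∀ q : ℝ≥0∞, 1 ≤ q → BoundedBelowOnRange (opMatrix A) (opMatrix P) q C' := by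
  set R := max RΛ RΓ with hR
  have hS := envelopeBound_lt_top hΘ R
  set K := 1 + envelopeBound Θ R + ENNReal.ofReal Cp with hK
  have hKtop : K ≠ ∞ := by simp [hK, hS.ne]
  -- The scale depends only on `Θ`, `Cp`, `R` and `d`: it is fixed before the sets, the operators,
  -- `p` and `q`.
  obtain ⟨s, hs, hsV⟩ := exists_scale_tsum_commBound_le hΘ R
    (ENNReal.div_pos (ENNReal.ofReal_pos.2 (half_pos hCp)).ne' hKtop)
  have hsmall : K * ∑' m, commBound Θ R s m ≤ ENNReal.ofReal (Cp / 2) :=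
    (mul_le_mul_right hsV K).trans ENNReal.mul_div_le
  have hDtop := (bumpBound_lt_top d R s).ne
  have hD : 0 < (bumpBound d R s).toReal := ENNReal.toReal_pos (bumpBound_pos d R s).ne' hDtop
  set D := (bumpBound d R s).toReal with hDdef
  -- Absorption leaves `Cp / 2`; each of the two comparisons between sequences and cubes costs a
  -- factor `D`.
  refine ⟨Cp / 2 / D ^ 2, by positivity, fun Λ Γ hΛ hΓ A P hPP hA hP => ?_⟩
  replace hΛ : relSep Λ ≤ R := hΛ.trans (by exact_mod_cast le_max_left _ _)
  replace hΓ : relSep Γ ≤ R := hΓ.trans (by exact_mod_cast le_max_right _ _)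
  have hAS := schurBound_of_envelope hΛ hΓ hA
  have hPS := schurBound_of_envelope hΓ hΓ hP
  refine ⟨fun q hq => ⟨hPS.actsOnEll hS hq, hAS.actsOnEll hS hq⟩,
    fun p hp hbelow q hq c u v hcu huv => ?_⟩
  have hPu := hPS.isMatrixImage_self hS (isMatrixImage_col_of_comp_self hPP) hq
    (lpn_ell_lt_top hq c) hcu
  have h := lpn_le_of_boundedBelowOnRange hΛ hΓ hΘ hs hA hP hp hq hCp.le hsmall hbelow
    (lpn_ell_lt_top hq u) hPu huv
  rw [← ofReal_norm_eq_lpn hq, ← ofReal_norm_eq_lpn hq, ← ENNReal.ofReal_toReal hDtop, ← hDdef,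
    ← ENNReal.ofReal_pow hD.le, ← ENNReal.ofReal_mul (by positivity),
    ← ENNReal.ofReal_mul (by positivity),
    ENNReal.ofReal_le_ofReal_iff (mul_nonneg (sq_nonneg _) (lp.norm_nonneg' _))] at h
  rw [div_mul_eq_mul_div, div_le_iff₀ (by positivity)]
  linarith
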